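/- Let $\omega,n\ge 1$ and $k\ge 0$ be integers with $n\ge 2k+1$, and let $i_0,\dots,i_{k-1}$ be integers. Let $A$ be the subset of the finite cyclic group $\mathbb{Z}_\omega=\mathbb{Z}/\omega\mathbb{Z}$ consisting of the residue classes modulo $\omega$ of the integers in $\{0,1,\dots,n-k-1\}\cup\{i_0,\dots,i_{k-1}\}$, and suppose that $|A|=n$. Let $B\subseteq\mathbb{Z}_\omega$ be such that $\mathbb{Z}_\omega=A+B$ is a factorization, that is, every $g\in\mathbb{Z}_\omega$ can be written as $g=a+b$ for exactly one pair $(a,b)\in A\times B$. Let $d=\gcd(|A|,|B|)$, and suppose that either $d$ has at most one distinct prime divisor, or $d=pq$ for primes $p,q$ with $\gcd\left(pq,\frac{|B|}{d}\right)=1$. Then $\{i_0,\dots,i_{k-1}\}\equiv\{n-k,n-k+1,\dots,n-1\}\pmod n$, that is, the two sets of integers have the same set of residue classes modulo $n$. Consequently $A$ is a complete set of residues modulo $n$: since $n\mid\omega$, reduction modulo $n$ is defined on $\mathbb{Z}_\omega$, and it maps $A$ bijectively onto $\mathbb{Z}/n\mathbb{Z}$. -/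

import Mathlib

/-- `G = A + B` is a factorization: every `g ∈ G` is `a + b` for a unique pair
`(a, b)` with `a ∈ A` and `b ∈ B`. -/
def IsFactorization {G : Type*} [AddCommGroup G] (A B : Finset G) : Prop :=
  ∀ g : G, ∃! p : G × G, p.1 ∈ A ∧ p.2 ∈ B ∧ p.1 + p.2 = g

/-- The integer sets `S` and `T` are congruent modulo `n`: they have the same set of
residue classes modulo `n`. -/
def SetModEq (n : ℕ) (S T : Finset ℤ) : Prop :=
  S.image (fun x : ℤ => (x : ZMod n)) = T.image (fun x : ℤ => (x : ZMod n))

/-- `A ⊆ ℤ/ω` is a complete set of residues modulo `n` (meant for `n ∣ ω`, where reduction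
`ℤ/ω → ℤ/n` makes sense): reduction modulo `n` is a bijection from `A` onto `ℤ/n`. -/
def IsCompleteResidueSet {ω : ℕ} (n : ℕ) (A : Finset (ZMod ω)) : Prop :=
  Set.BijOn (fun x : ZMod ω => (ZMod.cast x : ZMod n)) (A : Set (ZMod ω)) Set.univ

/-! It suffices that the elements of `A` are distinct modulo `n = |A|`: then `A` is a complete
residue system, and the stray integers must fill the classes missed by the interval. The main tool
is dilation (`bijective_nsmul_add_nsmul`): a factorization survives multiplying each factor by an
integer prime to its cardinality. Write `n = n' * h` and `m = |B| = m' * r` with `h` prime to `m`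
and `r` prime to `n`, so that `n'` and `m'` carry the shared primes. The interval contains `0` and
every proper divisor of `n`. A difference in `B` of the wrong divisibility type would, after
dilation, equal a difference in `A`, giving two representations of one element
(`exists_dvd_sub_of_bijective`). In both gcd cases this forces each class of `B` modulo `r` to be
constant modulo `n'`, and counting in `r * A + h * B` modulo `n * r` then separates `A` modulo `n`
(`eq_of_dvd_sub_of_bijective`). -/

/-! ### Dilating the factors of a factorization. -/

-- In the group algebra over `ZMod p`, Frobenius turns `F ^ p` into the sum over the dilated family,
-- while `F` acts on the sum `U` of all group elements as the scalar `|α|`, which is nonzero mod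
-- `p`.
open AddMonoidAlgebra in
theorem bijective_prime_nsmul_add {G α β : Type*} [AddCommGroup G] [Fintype G] [Fintype α]
    [Fintype β] {f : α → G} {g : β → G}
    (hfg : Function.Bijective fun x : α × β => f x.1 + g x.2) {p : ℕ} (hp : p.Prime)
    (hpα : ¬ p ∣ Fintype.card α) :
    Function.Bijective fun x : α × β => p • f x.1 + g x.2 := by
  classical
  have : Fact p.Prime := ⟨hp⟩
  have : CharP (AddMonoidAlgebra (ZMod p) G) p :=
    charP_of_injective_algebraMap (algebraMap (ZMod p) (AddMonoidAlgebra (ZMod p) G)).injective p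
  set F : AddMonoidAlgebra (ZMod p) G := ∑ a, single (f a) 1 with hF
  set H : AddMonoidAlgebra (ZMod p) G := ∑ b, single (g b) 1 with hH
  set U : AddMonoidAlgebra (ZMod p) G := ∑ x, single x 1 with hU
  have hFH : F * H = U := by
    rw [hF, hH, hU, Finset.sum_mul_sum, ← Fintype.sum_prod_type']
    simp only [single_mul_single, mul_one]
    exact hfg.sum_comp (fun x => single x (1 : ZMod p))
  have hsU (y : G) : single y (1 : ZMod p) * U = U := by
    rw [hU, Finset.mul_sum]
    simp only [single_mul_single, mul_one]
    exact (Equiv.addLeft y).bijective.sum_comp (fun x => single x (1 : ZMod p))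
  have hFU : F * U = (Fintype.card α : AddMonoidAlgebra (ZMod p) G) * U := by
    rw [hF, Finset.sum_mul]
    simp [hsU]
  have hFkU (k : ℕ) : F ^ k * U = ((Fintype.card α : ZMod p) ^ k) • U := by
    induction k with
    | zero => simp
    | succ k ih =>
      rw [pow_succ', mul_assoc, ih, mul_smul_comm, hFU, pow_succ, mul_smul, Algebra.smul_def
        (Fintype.card α : ZMod p) U]
      simp
  have hFp : F ^ p = ∑ a, single (p • f a) 1 := by
    rw [hF, sum_pow_char]
    simp [single_pow]
  have hcard : (Fintype.card α : ZMod p) ≠ 0 := by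
    rwa [Ne, ZMod.natCast_eq_zero_iff]
  have hmain : ∑ x : α × β, single (p • f x.1 + g x.2) (1 : ZMod p) = U := by
    have h1 : F ^ p * H = U := by
      obtain ⟨k, rfl⟩ : ∃ k, p = k + 1 := ⟨p - 1, by have := hp.pos; omega⟩
      rw [pow_succ, mul_assoc, hFH, hFkU]
      -- Fermat: `F ^ (p - 1)` fixes `U`, so `F ^ p * H = F ^ (p - 1) * U = U`.
      have := ZMod.pow_card_sub_one_eq_one hcard
      simp only [add_tsub_cancel_right] at this
      rw [this, one_smul]
    rw [← h1, hFp, hH, Finset.sum_mul_sum, ← Fintype.sum_prod_type']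
    simp only [single_mul_single, mul_one]
  rw [Fintype.bijective_iff_surjective_and_card]
  refine ⟨fun y => ?_, Fintype.card_of_bijective hfg⟩
  by_contra! hy
  -- A missed `y` would have coefficient `0` on the left but `1` in `U`.
  have h2 := congrArg (fun P => P.coeff y) hmain
  simp [hU, coeff_sum, Finsupp.single_apply, hy] at h2

theorem bijective_nsmul_add {G α β : Type*} [AddCommGroup G] [Fintype G] [Fintype α]
    [Fintype β] {f : α → G} {g : β → G}
    (hfg : Function.Bijective fun x : α × β => f x.1 + g x.2) {v : ℕ}
    (hv : v.Coprime (Fintype.card α)) :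
    Function.Bijective fun x : α × β => v • f x.1 + g x.2 := by
  induction v using Nat.recOnMul generalizing f with
  | zero =>
    -- Coprimality with `0` means `|α| = 1`, so dilating by `0` is only a translation.
    rw [Nat.coprime_zero_left, Fintype.card_eq_one_iff] at hv
    obtain ⟨a, ha⟩ := hv
    rw [Fintype.bijective_iff_surjective_and_card]
    refine ⟨fun y => ?_, Fintype.card_of_bijective hfg⟩
    obtain ⟨x, hx⟩ := hfg.2 (f a + y)
    refine ⟨x, ?_⟩
    simpa [ha x.1] using hx
  | one => simpa using hfg
  | prime p hp =>
    exact bijective_prime_nsmul_add hfg hp ((Nat.Prime.coprime_iff_not_dvd hp).1 hv)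
  | mul a b iha ihb =>
    simpa [mul_smul] using iha (f := fun x => b • f x) (ihb hfg hv.coprime_mul_left) hv.coprime_mul_right

theorem bijective_nsmul_add_nsmul {G α β : Type*} [AddCommGroup G] [Fintype G] [Fintype α]
    [Fintype β] {f : α → G} {g : β → G}
    (hfg : Function.Bijective fun x : α × β => f x.1 + g x.2) {v u : ℕ}
    (hv : v.Coprime (Fintype.card α)) (hu : u.Coprime (Fintype.card β)) :
    Function.Bijective fun x : α × β => v • f x.1 + u • g x.2 := by
  have h1 := bijective_nsmul_add hfg hv
  have h2 : Function.Bijective fun x : β × α => g x.1 + v • f x.2 := by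
    simpa [Function.comp_def, add_comm] using h1.comp (Equiv.prodComm β α).bijective
  simpa [Function.comp_def, add_comm] using
    (bijective_nsmul_add (f := g) (g := fun x => v • f x) h2 hu).comp (Equiv.prodComm α β).bijective


theorem bijective_mul_add_mul {ω : ℕ} [NeZero ω] {α β : Type*} [Fintype α] [Fintype β]
    {F : α → ℤ} {G : β → ℤ}
    (hFG : Function.Bijective fun x : α × β => ((F x.1 + G x.2 : ℤ) : ZMod ω)) {v u : ℕ}
    (hv : v.Coprime (Fintype.card α)) (hu : u.Coprime (Fintype.card β)) :
    Function.Bijective fun x : α × β => ((v * F x.1 + u * G x.2 : ℤ) : ZMod ω) := by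
  simpa using bijective_nsmul_add_nsmul (f := fun a => (F a : ZMod ω))
    (g := fun b => (G b : ZMod ω)) (by simpa using hFG) hv hu

theorem bijective_mul_add {ω : ℕ} [NeZero ω] {α β : Type*} [Fintype α] [Fintype β]
    {F : α → ℤ} {G : β → ℤ}
    (hFG : Function.Bijective fun x : α × β => ((F x.1 + G x.2 : ℤ) : ZMod ω)) {v : ℕ}
    (hv : v.Coprime (Fintype.card α)) :
    Function.Bijective fun x : α × β => ((v * F x.1 + G x.2 : ℤ) : ZMod ω) := by
  simpa only [Nat.cast_one, one_mul] using bijective_mul_add_mul hFG hv (Nat.coprime_one_left _)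

/-! ### Counting sums in a residue class. -/

theorem card_filter_dvd_sub_of_bijective {ω M : ℕ} [NeZero ω] (hM : M ∣ ω) {γ : Type*} [Fintype γ]
    {F : γ → ℤ} (hF : Function.Bijective fun x => (F x : ZMod ω)) (s : ℤ) :
    (Finset.univ.filter fun x => (M : ℤ) ∣ F x - s).card = ω / M := by
  classical
  have : NeZero M := ⟨fun h => NeZero.ne ω (by simpa [h] using hM)⟩
  let φ := ZMod.castHom hM (ZMod M)
  have hφ : Function.Surjective φ := ZMod.castHom_surjective hM
  have h1 (t : ZMod M) : (Finset.univ.filter fun y => φ y = t).card =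
      (Finset.univ.filter fun y => φ y = s).card :=
    AddMonoidHom.card_fiber_eq_of_mem_range φ (hφ _) (hφ _)
  have h2 : ω = M * (Finset.univ.filter fun y => φ y = s).card := by
    have := Finset.card_eq_sum_card_fiberwise (f := φ) (s := Finset.univ) (t := Finset.univ)
      (fun _ _ => Finset.mem_coe.2 (Finset.mem_univ _))
    simpa [h1] using this
  have h3 : (Finset.univ.filter fun x => (M : ℤ) ∣ F x - s).card =
      (Finset.univ.filter fun y => φ y = s).card := by
    refine Finset.card_bijective _ hF fun x => ?_
    simp only [Finset.mem_filter, Finset.mem_univ, true_and, map_intCast]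
    rw [eq_comm, ZMod.intCast_eq_intCast_iff_dvd_sub]
  rw [h3, eq_comm]
  exact Nat.div_eq_of_eq_mul_right (Nat.pos_of_neZero M) h2

/-- As `F` vanishes mod `r`, a sum congruent to `G b₀` mod `M` has `b` in the class of `b₀` mod `r`,
hence mod `M`. The pairs with such a sum therefore form a product set. -/
theorem card_filter_mul_card_filter_of_bijective {ω M r : ℕ} [NeZero ω] (hM : M ∣ ω)
    (hrM : r ∣ M) {α β : Type*} [Fintype α] [Fintype β] {F : α → ℤ} {G : β → ℤ}
    (hFG : Function.Bijective fun x : α × β => ((F x.1 + G x.2 : ℤ) : ZMod ω))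
    (hF : ∀ a, (r : ℤ) ∣ F a) (b₀ : β)
    (hG : ∀ b, (r : ℤ) ∣ G b - G b₀ → (M : ℤ) ∣ G b - G b₀) :
    (Finset.univ.filter fun a => (M : ℤ) ∣ F a).card *
      (Finset.univ.filter fun b => (r : ℤ) ∣ G b - G b₀).card = ω / M := by
  classical
  rw [← card_filter_dvd_sub_of_bijective hM hFG (G b₀), ← Finset.card_product]
  congr 1
  ext ⟨a, b⟩
  simp only [Finset.mem_product, Finset.mem_filter, Finset.mem_univ, true_and, add_sub_assoc]
  have hrM' : (r : ℤ) ∣ M := by exact_mod_cast hrM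
  refine ⟨fun h => dvd_add h.1 (hG b h.2), fun h => ?_⟩
  have h1 := hG b ((dvd_add_right (hF a)).1 (hrM'.trans h))
  exact ⟨(dvd_add_left h1).1 h, hrM'.trans h1⟩

/-! ### Differences in the second factor and separation of the first. -/

/-- Two differences which agree up to a unit cannot come from both factors. -/
theorem exists_dvd_sub_of_bijective {ω n m n' m' h r : ℕ} [NeZero ω] (hω : ω = n * m)
    (hn : n = n' * h) (hm : m = m' * r) {α β : Type*} [Fintype α] [Fintype β]
    (hα : Fintype.card α = n) (hβ : Fintype.card β = m) (hh : h.Coprime m) (hr : r.Coprime n)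
    {F : α → ℤ} {G : β → ℤ}
    (hFG : Function.Bijective fun x : α × β => ((F x.1 + G x.2 : ℤ) : ZMod ω))
    (hF : ∀ t, t ∣ n → t ≠ n → ∃ a a', ((F a - F a' : ℤ) : ZMod ω) = t)
    {b b' : β} (hb : b ≠ b') (hrb : (r : ℤ) ∣ G b - G b') :
    ∃ d, d ∣ n' * m' ∧ (d : ℤ) ∣ G b - G b' ∧ (d ∣ n' → d = n') := by
  have hω0 : ω ≠ 0 := NeZero.ne ω
  have hω' : ω = r * h * (n' * m') := by rw [hω, hn, hm]; ring
  have hrh0 : r * h ≠ 0 := fun h0 => hω0 (by rw [hω', h0, zero_mul])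
  obtain ⟨e, he⟩ := hrb
  -- Up to a unit, `h * (G b - G b')` is a divisor `D` of `ω`. Both `h` and `r` divide out of it,
  -- and `D / (r * h)` is the required `d`.
  obtain ⟨D, hD, u, hu, huD⟩ := ZMod.eq_unit_mul_divisor ((h * (G b - G b') : ℤ) : ZMod ω)
  obtain ⟨u, rfl⟩ := hu
  have hu' : (((u : ZMod ω).val : ℤ) : ZMod ω) = u := by simp
  have hv' : (((↑u⁻¹ : ZMod ω).val : ℤ) : ZMod ω) = (↑u⁻¹ : ZMod ω) := by simp
  have hinv : ((((↑u⁻¹ : ZMod ω).val : ℤ) * (h * (G b - G b')) : ℤ) : ZMod ω) = (D : ℤ) := by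
    rw [Int.cast_mul, hv', huD, ← mul_assoc, Units.inv_mul, one_mul, Int.cast_natCast]
  have hdvd := (ZMod.intCast_eq_intCast_iff_dvd_sub _ _ _).1 hinv
  have hDrh : r * h ∣ D := by
    have h1 : ((r * h : ℕ) : ℤ) ∣ ω := by rw [hω']; push_cast; exact dvd_mul_right _ _
    have h2 := h1.trans hdvd
    have h3 : ((r * h : ℕ) : ℤ) ∣ (((↑u⁻¹ : ZMod ω).val : ℤ) * (h * (G b - G b')) : ℤ) := by
      rw [he]; push_cast; exact ⟨(↑u⁻¹ : ZMod ω).val * e, by ring⟩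
    exact_mod_cast (dvd_sub_left h3).1 h2
  obtain ⟨d, rfl⟩ := hDrh
  have hd : d ∣ n' * m' := by
    rw [hω'] at hD
    exact Nat.dvd_of_mul_dvd_mul_left (Nat.pos_of_ne_zero hrh0) hD
  refine ⟨d, hd, ?_, fun hdn => ?_⟩
  · have h1 : ((h * (G b - G b') : ℤ) : ZMod ω)
        = (((u : ZMod ω).val * (r * h * d : ℕ) : ℤ) : ZMod ω) := by
      rw [huD, Int.cast_mul, hu', Int.cast_natCast]
    have h2 := (ZMod.intCast_eq_intCast_iff_dvd_sub _ _ _).1 h1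
    have h3 : ((r * h * d : ℕ) : ℤ) ∣ ω := by exact_mod_cast hD
    have h4 := (dvd_sub_right (Dvd.intro_left _ rfl)).1 (h3.trans h2)
    rw [he] at h4 ⊢
    have h5 : ((r * h : ℕ) : ℤ) * d ∣ (r * h : ℕ) * e := by
      refine (dvd_of_eq ?_).trans (h4.trans (dvd_of_eq ?_)) <;> push_cast <;> ring
    exact (Int.dvd_of_mul_dvd_mul_left (by exact_mod_cast hrh0) h5).mul_left _
  · by_contra hne
    have hh0 : 0 < h := Nat.pos_of_ne_zero fun h0 => hrh0 (by simp [h0])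
    -- If `d` properly divides `n'`, then `d * h` is a difference in the first factor. Dilating by
    -- `r` there and by `u⁻¹ * h` in the second factor makes both differences `r * h * d`, a
    -- collision.
    obtain ⟨a, a', haa⟩ := hF (d * h) (hn ▸ mul_dvd_mul_right hdn h)
      (by rw [hn]; exact fun h1 => hne (Nat.eq_of_mul_eq_mul_right hh0 h1))
    have huco : ((↑u⁻¹ : ZMod ω).val * h).Coprime (Fintype.card β) := by
      rw [hβ]
      refine Nat.Coprime.mul_left ?_ hh
      exact (ZMod.val_coe_unit_coprime u⁻¹).coprime_dvd_right (hω ▸ dvd_mul_left _ _)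
    have hb1 := (bijective_mul_add_mul hFG (hα ▸ hr) huco).1 (a₁ := (a, b')) (a₂ := (a', b)) (by
      simp only
      rw [← sub_eq_zero, ← Int.cast_sub]
      have : (r * F a + ((↑u⁻¹ : ZMod ω).val * h : ℕ) * G b' -
          (r * F a' + ((↑u⁻¹ : ZMod ω).val * h : ℕ) * G b) : ℤ) =
        r * (F a - F a') - (↑u⁻¹ : ZMod ω).val * (h * (G b - G b')) := by push_cast; ring
      rw [this, Int.cast_sub, hinv, Int.cast_mul, haa]
      push_cast
      ring)
    exact hb (congrArg Prod.snd hb1).symm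

/-- If the elements of `B` in one class modulo `r` agree modulo `n'`, then the elements of `A`
are distinct modulo `n`. -/
theorem eq_of_dvd_sub_of_bijective {ω n m n' m' h r : ℕ} [NeZero ω] (hω : ω = n * m)
    (hn : n = n' * h) (hm : m = m' * r) {α β : Type*} [Fintype α] [Fintype β]
    (hα : Fintype.card α = n) (hβ : Fintype.card β = m) (hh : h.Coprime m) (hr : r.Coprime n)
    {F : α → ℤ} {G : β → ℤ}
    (hFG : Function.Bijective fun x : α × β => ((F x.1 + G x.2 : ℤ) : ZMod ω))
    {b₀ : β} (hb₀ : (Finset.univ.filter fun b => (r : ℤ) ∣ G b - G b₀).card = m')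
    (hG : ∀ b, (r : ℤ) ∣ G b - G b₀ → (n' : ℤ) ∣ G b - G b₀)
    {a a' : α} (haa : (n : ℤ) ∣ F a - F a') : a = a' := by
  classical
  have hω0 : ω ≠ 0 := NeZero.ne ω
  have hnr : n * r ∣ ω := by rw [hω, hm]; exact ⟨m', by ring⟩
  have hnr0 : n * r ≠ 0 := fun h0 => hω0 (by simpa [h0] using hnr)
  have hm0 : 0 < m' := Nat.pos_of_ne_zero fun h0 => hω0 (by simp [hω, hm, h0])
  -- Exactly `m'` pairs of the dilated factorization fall in this class mod `n * r`. Each `x` with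
  -- `F x ≡ F a'` mod `n` pairs with all `m'` members of the class of `b₀`, so there is only one
  -- such `x`.
  have h1 := card_filter_dvd_sub_of_bijective hnr
    (bijective_mul_add_mul hFG (hα ▸ hr) (hβ ▸ hh)) (r * F a' + h * G b₀)
  have h2 : ω / (n * r) = m' := by
    refine Nat.div_eq_of_eq_mul_right (Nat.pos_of_ne_zero hnr0) ?_
    rw [hω, hm]; ring
  have hrn' : IsCoprime (r : ℤ) n' :=
    Nat.isCoprime_iff_coprime.2 (hr.coprime_dvd_right (hn ▸ dvd_mul_right _ _))
  have h3 : (Finset.univ.filter fun x => (n : ℤ) ∣ F x - F a') ×ˢ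
      (Finset.univ.filter fun b => (r : ℤ) ∣ G b - G b₀) ⊆
      Finset.univ.filter fun x : α × β => ((n * r : ℕ) : ℤ) ∣ (r * F x.1 + h * G x.2) -
        (r * F a' + h * G b₀) := by
    rintro ⟨x, b⟩ hx
    simp only [Finset.mem_product, Finset.mem_filter, Finset.mem_univ, true_and] at hx ⊢
    have h4 := mul_dvd_mul_left (h : ℤ) (hrn'.mul_dvd hx.2 (hG b hx.2))
    have h5 := mul_dvd_mul_left (r : ℤ) hx.1
    have h6 : ((n * r : ℕ) : ℤ) = r * n := by push_cast; ring
    have h7 : (h : ℤ) * (r * n') = r * n := by rw [hn]; push_cast; ring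
    rw [h6]
    rw [h7] at h4
    refine (dvd_add h5 h4).trans (dvd_of_eq (by ring))
  have h4 := Finset.card_le_card h3
  rw [Finset.card_product, h1, h2, hb₀] at h4
  have h5 : (Finset.univ.filter fun x => (n : ℤ) ∣ F x - F a').card ≤ 1 :=
    Nat.le_of_mul_le_mul_right (by simpa using h4) hm0
  exact Finset.card_le_one.1 h5 _ (by simpa using haa) _ (by simp)

/-- After dilating the first factor by `r`, sums mod `r` depend on `b` alone, so the second factor
is equidistributed mod `r`. -/
theorem card_filter_dvd_sub_right_of_bijective {ω n m m' r : ℕ} [NeZero ω] (hω : ω = n * m)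
    (hm : m = m' * r) {α β : Type*} [Fintype α] [Fintype β]
    (hα : Fintype.card α = n) (hr : r.Coprime n) {F : α → ℤ} {G : β → ℤ}
    (hFG : Function.Bijective fun x : α × β => ((F x.1 + G x.2 : ℤ) : ZMod ω)) (b₀ : β) :
    (Finset.univ.filter fun b => (r : ℤ) ∣ G b - G b₀).card = m' := by
  have hω0 : ω ≠ 0 := NeZero.ne ω
  have h1 := card_filter_mul_card_filter_of_bijective (ω := ω) (M := r) (G := G) (F := fun a => r * F a) (b₀ := b₀)
    (by rw [hω, hm]; exact ⟨n * m', by ring⟩) dvd_rfl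
    (bijective_mul_add hFG (hα ▸ hr))
    (fun a => dvd_mul_right _ _) (fun b hb => hb)
  have h2 : ω / r = n * m' := by
    refine Nat.div_eq_of_eq_mul_left (Nat.pos_of_ne_zero fun h0 => hω0 (by simp [hω, hm, h0])) ?_
    rw [hω, hm]; ring
  simp only [dvd_mul_right, Finset.filter_true, Finset.card_univ, hα, h2] at h1
  exact Nat.eq_of_mul_eq_mul_left (Nat.pos_of_ne_zero fun h0 => hω0 (by simp [hω, h0])) h1

/-! ### The two gcd cases. -/

/-- Divisors of a prime power form a chain: `d` either divides `n' = p ^ i`, hence equals it, or is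
a multiple of it. -/
theorem eq_of_dvd_sub_of_prime_pow {ω n m h r p i j : ℕ} [NeZero ω] (hω : ω = n * m)
    (hp : p.Prime) (hn : n = p ^ i * h) (hm : m = p ^ j * r) {α β : Type*} [Fintype α] [Fintype β]
    (hα : Fintype.card α = n) (hβ : Fintype.card β = m) (hh : h.Coprime m) (hr : r.Coprime n)
    {F : α → ℤ} {G : β → ℤ}
    (hFG : Function.Bijective fun x : α × β => ((F x.1 + G x.2 : ℤ) : ZMod ω))
    (hF : ∀ t, t ∣ n → t ≠ n → ∃ a a', ((F a - F a' : ℤ) : ZMod ω) = t)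
    {a a' : α} (haa : (n : ℤ) ∣ F a - F a') : a = a' := by
  obtain ⟨⟨-, b₀⟩, -⟩ := hFG.2 0
  refine eq_of_dvd_sub_of_bijective hω hn hm hα hβ hh hr hFG
    (card_filter_dvd_sub_right_of_bijective hω hm hα hr hFG b₀) (fun b hb => ?_) haa
  rcases eq_or_ne b b₀ with rfl | hne
  · simp
  obtain ⟨d, hd, hdG, hdn⟩ := exists_dvd_sub_of_bijective hω hn hm hα hβ hh hr hFG hF hne hb
  rw [← pow_add, Nat.dvd_prime_pow hp] at hd
  obtain ⟨k, -, rfl⟩ := hd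
  rcases le_total k i with hk | hk
  · rwa [hdn (pow_dvd_pow p hk)] at hdG
  · exact Dvd.dvd.trans (by exact_mod_cast pow_dvd_pow p hk) hdG

/-- The class of `b₀` mod `r` has `p * q` elements. Were it constant mod `p ^ (i + 1)`, counting
sums mod `p ^ (i + 1) * r` would give `p * q ∣ q ^ (j + 1) * h`, yet `p` divides neither `q` nor
`h`. -/
theorem not_forall_dvd_sub {ω n m h r p q i j : ℕ} [NeZero ω] (hω : ω = n * m)
    (hp : p.Prime) (hq : q.Prime) (hpq : p ≠ q) (hn : n = p ^ i * q ^ j * h)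
    (hm : m = p * q * r) {α β : Type*} [Fintype α] [Fintype β]
    (hα : Fintype.card α = n) (hh : h.Coprime m) (hr : r.Coprime n)
    {F : α → ℤ} {G : β → ℤ}
    (hFG : Function.Bijective fun x : α × β => ((F x.1 + G x.2 : ℤ) : ZMod ω)) (b₀ : β)
    (hpr : r.Coprime p)
    (hG : ∀ b, (r : ℤ) ∣ G b - G b₀ → ((p ^ (i + 1) : ℕ) : ℤ) ∣ G b - G b₀) : False := by
  have hω0 : ω ≠ 0 := NeZero.ne ω
  have hω' : ω = p ^ (i + 1) * r * (q ^ (j + 1) * h) := by rw [hω, hn, hm]; ring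
  have h1 := card_filter_mul_card_filter_of_bijective (M := p ^ (i + 1) * r) (r := r)
    (ω := ω) (G := G) (F := fun a => r * F a) (b₀ := b₀) (by rw [hω']; exact dvd_mul_right _ _) (dvd_mul_left _ _)
    (bijective_mul_add hFG (hα ▸ hr))
    (fun a => dvd_mul_right _ _) (fun b hb => by
      push_cast
      refine IsCoprime.mul_dvd ?_ (by exact_mod_cast hG b hb) hb
      exact_mod_cast Nat.isCoprime_iff_coprime.2 (hpr.symm.pow_left (i + 1)))
  rw [card_filter_dvd_sub_right_of_bijective hω hm hα hr hFG b₀, hω', Nat.mul_div_cancel_left _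
    (Nat.pos_of_ne_zero fun h0 => hω0 (by rw [hω', h0, zero_mul]))] at h1
  have h2 : p ∣ q ^ (j + 1) * h := h1 ▸ ⟨_, mul_left_comm _ _ _⟩
  rcases hp.dvd_mul.1 h2 with h3 | h3
  · exact hpq ((Nat.prime_dvd_prime_iff_eq hp hq).1 (hp.dvd_of_dvd_pow h3))
  · exact Nat.not_coprime_of_dvd_of_dvd hp.one_lt h3 (hm ▸ ⟨q * r, by ring⟩) hh

theorem eq_of_dvd_sub_of_prime_mul_prime {ω n m h r p q i j : ℕ} [NeZero ω] (hω : ω = n * m)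
    (hp : p.Prime) (hq : q.Prime) (hpq : p ≠ q) (hn : n = p ^ i * q ^ j * h)
    (hm : m = p * q * r) {α β : Type*} [Fintype α] [Fintype β]
    (hα : Fintype.card α = n) (hβ : Fintype.card β = m) (hh : h.Coprime m) (hr : r.Coprime n)
    (hpr : r.Coprime p) (hqr : r.Coprime q) {F : α → ℤ} {G : β → ℤ}
    (hFG : Function.Bijective fun x : α × β => ((F x.1 + G x.2 : ℤ) : ZMod ω))
    (hF : ∀ t, t ∣ n → t ≠ n → ∃ a a', ((F a - F a' : ℤ) : ZMod ω) = t)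
    {a a' : α} (haa : (n : ℤ) ∣ F a - F a') : a = a' := by
  obtain ⟨⟨-, b₀⟩, -⟩ := hFG.2 0
  have hcop : IsCoprime ((p ^ i : ℕ) : ℤ) (q ^ j : ℕ) :=
    Nat.isCoprime_iff_coprime.2 (((Nat.coprime_primes hp hq).2 hpq).pow i j)
  -- A divisor of `p ^ (i + 1) * q ^ (j + 1)` either has a full power of `p` or of `q`, or divides
  -- `n' = p ^ i * q ^ j` and so equals it.
  have key : ∀ b b', (r : ℤ) ∣ G b - G b' →
      (((p ^ i : ℕ) : ℤ) ∣ G b - G b' ∧ ((q ^ j : ℕ) : ℤ) ∣ G b - G b') ∨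
      ((p ^ (i + 1) : ℕ) : ℤ) ∣ G b - G b' ∨ ((q ^ (j + 1) : ℕ) : ℤ) ∣ G b - G b' := by
    intro b b' hb
    rcases eq_or_ne b b' with rfl | hne
    · simp
    obtain ⟨d, hd, hdG, hdn⟩ := exists_dvd_sub_of_bijective hω hn hm hα hβ hh hr hFG hF hne hb
    have hd' : d ∣ p ^ (i + 1) * q ^ (j + 1) := hd.trans (dvd_of_eq (by ring))
    obtain ⟨x, y, hx, hy, rfl⟩ := (Nat.dvd_mul).1 hd'
    rw [Nat.dvd_prime_pow hp] at hx
    rw [Nat.dvd_prime_pow hq] at hy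
    obtain ⟨k, hk, rfl⟩ := hx
    obtain ⟨l, hl, rfl⟩ := hy
    rcases hk.eq_or_lt with rfl | hk
    · exact .inr (.inl (Dvd.dvd.trans (by exact_mod_cast dvd_mul_right _ _) hdG))
    rcases hl.eq_or_lt with rfl | hl
    · exact .inr (.inr (Dvd.dvd.trans (by exact_mod_cast dvd_mul_left _ _) hdG))
    rw [hdn (mul_dvd_mul (pow_dvd_pow p (by omega)) (pow_dvd_pow q (by omega)))] at hdG
    exact .inl ⟨Dvd.dvd.trans (by exact_mod_cast dvd_mul_right _ _) hdG,
      Dvd.dvd.trans (by exact_mod_cast dvd_mul_left _ _) hdG⟩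
  have hpp : ((p ^ i : ℕ) : ℤ) ∣ (p ^ (i + 1) : ℕ) := by exact_mod_cast pow_dvd_pow p (by omega)
  have hqq : ((q ^ j : ℕ) : ℤ) ∣ (q ^ (j + 1) : ℕ) := by exact_mod_cast pow_dvd_pow q (by omega)
  have hn2 : n = q ^ j * p ^ i * h := by rw [hn]; ring
  have hm2 : m = q * p * r := by rw [hm]; ring
  refine eq_of_dvd_sub_of_bijective hω hn hm hα hβ hh hr hFG
    (card_filter_dvd_sub_right_of_bijective hω hm hα hr hFG b₀) (fun b hb => ?_) haa
  push_cast
  refine IsCoprime.mul_dvd (by exact_mod_cast hcop) ?_ ?_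
  · by_contra hnp
    have hnp : ¬ ((p ^ i : ℕ) : ℤ) ∣ G b - G b₀ := by exact_mod_cast hnp
    -- If `b` differs from `b₀` mod `p ^ i`, they agree mod `q ^ (j + 1)`. Any `c` differing from
    -- `b₀` mod `q ^ (j + 1)` agrees with it mod `p ^ i`, and then the pair `b`, `c` violates `key`.
    -- So the whole class would be constant mod `q ^ (j + 1)`.
    refine not_forall_dvd_sub hω hq hp hpq.symm hn2 hm2 hα hh hr hFG b₀ hqr fun c hc => ?_
    by_contra hcq
    have hpc : ((p ^ i : ℕ) : ℤ) ∣ G c - G b₀ := by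
      rcases key c b₀ hc with h1 | h1 | h1
      exacts [h1.1, hpp.trans h1, absurd h1 hcq]
    have hqb : ((q ^ (j + 1) : ℕ) : ℤ) ∣ G b - G b₀ := by
      rcases key b b₀ hb with h1 | h1 | h1
      exacts [absurd h1.1 hnp, absurd (hpp.trans h1) hnp, h1]
    have hbc : ((p ^ i : ℕ) : ℤ) ∣ G b - G c := by
      rcases key b c (by simpa using dvd_sub hb hc) with h1 | h1 | h1
      · exact h1.1
      · exact hpp.trans h1
      · exact absurd (by simpa using dvd_sub hqb h1) hcq
    exact hnp (by simpa using dvd_add hbc hpc)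
  · by_contra hnq
    have hnq : ¬ ((q ^ j : ℕ) : ℤ) ∣ G b - G b₀ := by exact_mod_cast hnq
    refine not_forall_dvd_sub hω hp hq hpq hn hm hα hh hr hFG b₀ hpr fun c hc => ?_
    by_contra hcp
    have hqc : ((q ^ j : ℕ) : ℤ) ∣ G c - G b₀ := by
      rcases key c b₀ hc with h1 | h1 | h1
      exacts [h1.2, absurd h1 hcp, hqq.trans h1]
    have hpb : ((p ^ (i + 1) : ℕ) : ℤ) ∣ G b - G b₀ := by
      rcases key b b₀ hb with h1 | h1 | h1
      exacts [absurd h1.2 hnq, h1, absurd (hqq.trans h1) hnq]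
    have hbc : ((q ^ j : ℕ) : ℤ) ∣ G b - G c := by
      rcases key b c (by simpa using dvd_sub hb hc) with h1 | h1 | h1
      · exact h1.2
      · exact absurd (by simpa using dvd_sub hpb h1) hcp
      · exact hqq.trans h1
    exact hnq (by simpa using dvd_add hbc hqc)

theorem eq_of_dvd_sub_of_gcd {ω n m : ℕ} [NeZero ω] (hω : ω = n * m)
    (hgcd : (n.gcd m).primeFactors.card ≤ 1 ∨ ∃ p q : ℕ, p.Prime ∧ q.Prime ∧ n.gcd m = p * q ∧
      Nat.gcd (p * q) (m / n.gcd m) = 1)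
    {α β : Type*} [Fintype α] [Fintype β] (hα : Fintype.card α = n) (hβ : Fintype.card β = m)
    {F : α → ℤ} {G : β → ℤ}
    (hFG : Function.Bijective fun x : α × β => ((F x.1 + G x.2 : ℤ) : ZMod ω))
    (hF : ∀ t, t ∣ n → t ≠ n → ∃ a a', ((F a - F a' : ℤ) : ZMod ω) = t)
    {a a' : α} (haa : (n : ℤ) ∣ F a - F a') : a = a' := by
  have hω0 : ω ≠ 0 := NeZero.ne ω
  have hn0 : n ≠ 0 := fun h0 => hω0 (by simp [hω, h0])
  have hm0 : m ≠ 0 := fun h0 => hω0 (by simp [hω, h0])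
  have hd0 : n.gcd m ≠ 0 := Nat.gcd_ne_zero_left hn0
  have hone (hd : (n.gcd m).primeFactors.card ≤ 1) : a = a' := by
    obtain ⟨p, hp, hpu⟩ : ∃ p : ℕ, p.Prime ∧ ∀ l : ℕ, l.Prime → l ∣ n → l ∣ m → l = p := by
      rcases (n.gcd m).primeFactors.eq_empty_or_nonempty with h0 | ⟨p, hp⟩
      -- With no shared prime, any prime serves as `p`; `2` is a default.
      · refine ⟨2, Nat.prime_two, fun l hl h1 h2 => ?_⟩
        have : l ∈ (n.gcd m).primeFactors := Nat.mem_primeFactors.2 ⟨hl, Nat.dvd_gcd h1 h2, hd0⟩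
        simp [h0] at this
      · exact ⟨p, Nat.prime_of_mem_primeFactors hp, fun l hl h1 h2 => Finset.card_le_one.1 hd _
          (Nat.mem_primeFactors.2 ⟨hl, Nat.dvd_gcd h1 h2, hd0⟩) _ hp⟩
    have h1 : (ordCompl[p] n).Coprime m := Nat.coprime_of_dvd fun l hl h2 h3 =>
      Nat.not_dvd_ordCompl hp hn0 (hpu l hl (h2.trans (Nat.ordCompl_dvd n p)) h3 ▸ h2)
    have h2 : (ordCompl[p] m).Coprime n := Nat.coprime_of_dvd fun l hl h2 h3 =>
      Nat.not_dvd_ordCompl hp hm0 (hpu l hl h3 (h2.trans (Nat.ordCompl_dvd m p)) ▸ h2)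
    exact eq_of_dvd_sub_of_prime_pow hω hp (Nat.ordProj_mul_ordCompl_eq_self n p).symm
      (Nat.ordProj_mul_ordCompl_eq_self m p).symm hα hβ h1 h2 hFG hF haa
  rcases hgcd with hd | ⟨p, q, hp, hq, hd, hcop⟩
  · exact hone hd
  rcases eq_or_ne p q with rfl | hpq
  · refine hone ?_
    rw [hd, ← pow_two, Nat.primeFactors_prime_pow two_ne_zero hp, Finset.card_singleton]
  set r := m / n.gcd m with hr
  have hm : m = p * q * r := by
    rw [hr, ← hd, Nat.mul_div_cancel' (Nat.gcd_dvd_right n m)]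
  have hn1 : n = p ^ n.factorization p * ordCompl[p] n :=
    (Nat.ordProj_mul_ordCompl_eq_self n p).symm
  set n₁ := ordCompl[p] n with hn₁
  have hn10 : n₁ ≠ 0 := fun h0 => hn0 (by rw [hn1, h0, mul_zero])
  have hn2 : n₁ = q ^ n₁.factorization q * ordCompl[q] n₁ :=
    (Nat.ordProj_mul_ordCompl_eq_self n₁ q).symm
  have hn3 : n = p ^ n.factorization p * q ^ n₁.factorization q * ordCompl[q] n₁ := by
    rw [mul_assoc, ← hn2, ← hn1]
  have hrn : r.Coprime n := Nat.coprime_of_dvd fun l hl h1 h2 => by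
    have h3 : l ∣ p * q := hd ▸ Nat.dvd_gcd h2 (h1.trans (hm ▸ dvd_mul_left _ _))
    exact Nat.not_coprime_of_dvd_of_dvd hl.one_lt h3 h1 hcop
  have hh : (ordCompl[q] n₁).Coprime m := Nat.coprime_of_dvd fun l hl h1 h2 => by
    have h3 : l ∣ n₁ := h1.trans (Nat.ordCompl_dvd _ _)
    have h4 : l ∣ p * q := hd ▸ Nat.dvd_gcd (h3.trans (Nat.ordCompl_dvd _ _)) h2
    rcases hl.dvd_mul.1 h4 with h5 | h5
    · obtain rfl := (Nat.prime_dvd_prime_iff_eq hl hp).1 h5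
      exact Nat.not_dvd_ordCompl hp hn0 h3
    · exact Nat.not_dvd_ordCompl hq hn10 ((Nat.prime_dvd_prime_iff_eq hl hq).1 h5 ▸ h1)
  have hcop' : r.Coprime (p * q) := Nat.Coprime.symm hcop
  exact eq_of_dvd_sub_of_prime_mul_prime hω hp hq hpq hn3 hm hα hβ hh hrn
    hcop'.coprime_mul_right_right hcop'.coprime_mul_left_right hFG hF haa

/-! ### From distinctness modulo `n` to the theorem. -/

theorem IsFactorization.bijective {ω : ℕ} [NeZero ω] {A B : Finset (ZMod ω)}
    (hAB : IsFactorization A B) :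
    Function.Bijective fun x : A × B =>
      (((x.1.1.val : ℤ) + (x.2.1.val : ℤ) : ℤ) : ZMod ω) := by
  have hcast (x : A × B) :
      (((x.1.1.val : ℤ) + (x.2.1.val : ℤ) : ℤ) : ZMod ω) = x.1 + x.2 := by simp
  simp only [hcast]
  refine ⟨fun x y hxy => ?_, fun g => ?_⟩
  · have h := (hAB (x.1 + x.2)).unique (y₁ := (x.1.1, x.2.1)) (y₂ := (y.1.1, y.2.1))
      ⟨x.1.2, x.2.2, rfl⟩ ⟨y.1.2, y.2.2, hxy.symm⟩
    rw [Prod.mk.injEq] at h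
    exact Prod.ext (Subtype.ext h.1) (Subtype.ext h.2)
  · obtain ⟨⟨a, b⟩, ⟨ha, hb, hg⟩, -⟩ := hAB g
    exact ⟨(⟨a, ha⟩, ⟨b, hb⟩), hg⟩

theorem Finset.eq_compl_of_union_eq_univ {γ : Type*} [Fintype γ] [DecidableEq γ] {s t : Finset γ}
    (h : s ∪ t = univ) (hcard : s.card + t.card ≤ Fintype.card γ) : t = sᶜ := by
  refine (eq_of_subset_of_card_le (fun x hx => ?_) ?_).symm
  · have := h ▸ mem_univ x
    exact (mem_union.1 this).resolve_left (mem_compl.1 hx)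
  · rw [card_compl]
    omega

theorem theorem1 (ω : ℕ) [NeZero ω] (n k : ℕ) (i : Fin k → ℤ)
    (A B : Finset (ZMod ω))
    (hAB : IsFactorization A B)
    (hA : A = (Finset.Icc (0 : ℤ) ((n : ℤ) - (k : ℤ) - 1) ∪ Finset.univ.image i).image
      (fun x : ℤ => (x : ZMod ω)))
    (hcard : A.card = n)
    (hn : 2 * k + 1 ≤ n)
    (hgcd : (Nat.gcd A.card B.card).primeFactors.card ≤ 1 ∨
      ∃ p q : ℕ, p.Prime ∧ q.Prime ∧ Nat.gcd A.card B.card = p * q ∧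
        Nat.gcd (p * q) (B.card / Nat.gcd A.card B.card) = 1) :
    SetModEq n (Finset.univ.image i) (Finset.Icc ((n : ℤ) - (k : ℤ)) ((n : ℤ) - 1)) ∧
      IsCompleteResidueSet n A := by
  have : NeZero n := ⟨by omega⟩
  have hbij := hAB.bijective
  have hω : ω = n * B.card := by
    simpa [hcard] using (Fintype.card_of_bijective hbij).symm
  -- This is where `2 * k + 1 ≤ n` enters: the interval reaches `n / 2`, which bounds every proper
  -- divisor of `n`.
  have hmem (t : ℕ) (ht : 2 * t ≤ n) : (t : ZMod ω) ∈ A := by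
    rw [hA]
    exact Finset.mem_image.2 ⟨t, Finset.mem_union_left _ (Finset.mem_Icc.2 (by omega)), by simp⟩
  have hinj : Set.InjOn (fun x : ZMod ω => (ZMod.cast x : ZMod n)) A := by
    intro x hx y hy hxy
    rw [hcard] at hgcd
    have := eq_of_dvd_sub_of_gcd hω hgcd (by simpa using hcard) (Fintype.card_coe B)
      (F := fun a : A => (a.1.val : ℤ)) (G := fun b : B => (b.1.val : ℤ)) hbij (fun t htn hne => ?_)
      (a := ⟨x, hx⟩) (a' := ⟨y, hy⟩) ?_
    · exact congrArg Subtype.val this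
    · obtain ⟨c, rfl⟩ := htn
      have hc : 2 ≤ c := by
        by_contra! hc
        interval_cases c <;> simp_all
      refine ⟨⟨t, hmem t (by nlinarith)⟩, ⟨0, by simpa using hmem 0 (by simp)⟩, ?_⟩
      simp
    · rw [← ZMod.intCast_eq_intCast_iff_dvd_sub]
      simpa using hxy.symm
  have hcomplete : IsCompleteResidueSet n A := by
    refine ⟨fun _ _ => Set.mem_univ _, hinj, ?_⟩
    have := Finset.surjOn_of_injOn_of_card_le (s := A) (t := (Finset.univ : Finset (ZMod n)))
      (fun x : ZMod ω => (ZMod.cast x : ZMod n)) (fun _ _ => by simp) hinj (by simp [hcard])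
    simpa using this
  refine ⟨?_, hcomplete⟩
  have hnω : n ∣ ω := hω ▸ dvd_mul_right _ _
  have hcardW : ((Finset.Icc (0 : ℤ) ((n : ℤ) - (k : ℤ) - 1)).image
      fun x : ℤ => (x : ZMod n)).card ≤ n - k :=
    Finset.card_image_le.trans (by rw [Int.card_Icc]; omega)
  unfold SetModEq
  -- Both sets have at most `k` residues and, together with the at most `n - k` residues of the
  -- interval, cover `ZMod n`; so each is the complement of the interval's image.
  rw [Finset.eq_compl_of_union_eq_univ (t := (Finset.univ.image i).image _)
      (s := (Finset.Icc (0 : ℤ) ((n : ℤ) - (k : ℤ) - 1)).image fun x : ℤ => (x : ZMod n)),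
    Finset.eq_compl_of_union_eq_univ (t := (Finset.Icc ((n : ℤ) - (k : ℤ)) ((n : ℤ) - 1)).image _)
      (s := (Finset.Icc (0 : ℤ) ((n : ℤ) - (k : ℤ) - 1)).image fun x : ℤ => (x : ZMod n))]
  · rw [← Finset.image_union, Finset.eq_univ_iff_forall]
    intro y
    have hy := y.val_lt
    refine Finset.mem_image.2 ⟨y.val, ?_, by simp⟩
    rw [Finset.mem_union, Finset.mem_Icc, Finset.mem_Icc]
    omega
  · have : ((Finset.Icc ((n : ℤ) - (k : ℤ)) ((n : ℤ) - 1)).image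
        fun x : ℤ => (x : ZMod n)).card ≤ k :=
      Finset.card_image_le.trans (by rw [Int.card_Icc]; omega)
    rw [ZMod.card]
    omega
  · rw [← Finset.image_union, Finset.eq_univ_iff_forall]
    intro y
    obtain ⟨x, hx, rfl⟩ := hcomplete.surjOn (Set.mem_univ y)
    rw [Finset.mem_coe, hA, Finset.mem_image] at hx
    obtain ⟨z, hz, rfl⟩ := hx
    exact Finset.mem_image.2 ⟨z, hz, (ZMod.cast_intCast hnω z).symm⟩
  · have : ((Finset.univ.image i).image fun x : ℤ => (x : ZMod n)).card ≤ k :=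
      Finset.card_image_le.trans (Finset.card_image_le.trans (by simp))
    rw [ZMod.card]
    omega
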